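/- Let $R$ be a closed region of the Euclidean plane and $\alpha>0$. Travelling costs $\alpha$ per unit of length in the interior of $R$, $1$ outside $R$, and $\min\{1,\alpha\}$ along the boundary of $R$; the weighted length of a rectifiable path is the integral of this cost along it. The Weighted Region Problem with weights $\{1,\alpha\}$ asks, for given points $s,t$, for a shortest path from $s$ to $t$, that is, one of minimum weighted length among all rectifiable paths from $s$ to $t$. An instance is solved exactly in the Algebraic Computation Model over the Rationals (ACM$\mathbb{Q}$) if some shortest path is a polygonal chain all of whose vertices have coordinates obtainable from rational numbers by finitely many operations $+,-,\times,\div$ and $\sqrt[k]{\ }$, $k\ge 2$ (complex intermediate values allowed). **Theorem.** The Weighted Region Problem with weights in $\{1,\alpha\}$, where $0<\alpha<\sqrt2$ and $\alpha\ne1$, cannot be solved exactly in the ACM$\mathbb{Q}$, even if $R$ is a single quadrant. More precisely, there are a rational number $\alpha\in(0,\sqrt2)\setminus\{1\}$, an axis-parallel quadrant $R$ with rational corner, and points $s,t\notin R$ with rational coordinates, such that a polygonal shortest path from $s$ to $t$ exists, but no shortest path from $s$ to $t$ is a polygonal chain all of whose vertices have coordinates computable in the ACM$\mathbb{Q}$.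 The same holds for an axis-parallel rectangle $R$ with rational corners in place of the quadrant. -/

import Mathlib

open Set

noncomputable section

/-- The Euclidean plane. -/
abbrev Plane : Type := EuclideanSpace ℝ (Fin 2)

/-- A point with rational coordinates, as a point of the Euclidean plane. -/
def ratPoint (p : ℚ × ℚ) : Plane := !₂[(p.1 : ℝ), (p.2 : ℝ)]

/-- The closed axis-parallel quadrant whose top-left corner is `O`. -/
def quadrant (O : Plane) : Set Plane := {x | O 0 ≤ x 0 ∧ x 1 ≤ O 1}

/-- The closed axis-parallel rectangle with bottom-left corner `A` and top-right corner `B`. -/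
def rectangle (A B : Plane) : Set Plane :=
  {x | A 0 ≤ x 0 ∧ x 0 ≤ B 0 ∧ A 1 ≤ x 1 ∧ x 1 ≤ B 1}

open Classical in
/-- Cost per unit of Euclidean length at the point `x`, for a region `R` of weight `α` in a plane
that has weight `1` elsewhere; along the boundary of `R` the cheaper of the two weights counts. -/
def regionWeight (R : Set Plane) (α : ℝ) (x : Plane) : ℝ :=
  if x ∈ interior R then α else if x ∈ frontier R then min 1 α else 1

/-- `γ`, restricted to `[0, 1]`, is a rectifiable path from `s` to `t`, in a Lipschitz
parametrization. -/
def IsPathFromTo (s t : Plane) (γ : ℝ → Plane) : Prop :=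
  (∃ K, LipschitzOnWith K γ (Icc 0 1)) ∧ γ 0 = s ∧ γ 1 = t

/-- The weighted length of the path `γ` on `[0, 1]`. -/
def weightedLength (R : Set Plane) (α : ℝ) (γ : ℝ → Plane) : ℝ :=
  ∫ τ in (0 : ℝ)..1, regionWeight R α (γ τ) * ‖deriv γ τ‖

/-- The weighted length of the polygonal chain with the given list of vertices. -/
def chainLength (R : Set Plane) (α : ℝ) : List Plane → ℝ
  | [] => 0
  | [_] => 0
  | p :: q :: l =>
      weightedLength R α (fun τ => AffineMap.lineMap p q τ) + chainLength R α (q :: l)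

/-- The polygonal chain with vertex list `L` is a shortest path from `s` to `t`: it starts at `s`,
ends at `t`, and no rectifiable path from `s` to `t` has smaller weighted length. -/
structure IsShortestChain (R : Set Plane) (α : ℝ) (s t : Plane) (L : List Plane) : Prop where
  head_eq : L.head? = some s
  last_eq : L.getLast? = some t
  le_length : ∀ γ : ℝ → Plane, IsPathFromTo s t γ → chainLength R α L ≤ weightedLength R α γ

/-- A real number is computable in the algebraic computation model over the rationals: it is
obtained from rational numbers by finitely many operations `+`, `-`, `×`, `÷` and `k`-th roots.
The intermediate values may be complex and every complex `k`-th root is admitted. -/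
def ACMComputable (x : ℝ) : Prop := (x : ℂ) ∈ solvableByRad ℚ ℂ

/-- The instance `(R, α, s, t)` of the weighted region problem is solved exactly in the algebraic
computation model over the rationals: some shortest path from `s` to `t` is a polygonal chain all
of whose vertices have computable coordinates. -/
def SolvableInACM (R : Set Plane) (α : ℝ) (s t : Plane) : Prop :=
  ∃ L : List Plane, IsShortestChain R α s t L ∧ ∀ p ∈ L, ∀ i, ACMComputable (p i)

end

/-!
A ray that enters the fourth quadrant through its horizontal side and leaves it through its vertical
side, refracted according to Snell's law, is calibrated: the piecewise linear function whose
gradient is the direction of the ray before, inside and behind the quadrant grows along any path by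
at most the weighted length of the path, with equality along the ray. So the ray is a shortest path,
and every shortest polygonal chain leaves its starting point in the direction of the ray.

For the weight `7 / 5` and suitable endpoints, this direction is given by a root of an irreducible
integer polynomial of degree 11 that has two real roots, but not only real roots. A nontrivial
element of a solvable transitive permutation group of prime degree has at most one fixed point. If
a root were expressible by radicals, the two real roots would therefore generate the splitting
field, and all roots would be real.
-/

section PrimeDegreeGroups

open MulAction

theorem exists_normal_isMulCommutative_ne_bot (G : Type*) [Group G] [Group.IsSolvable G]
    [Nontrivial G] : ∃ A : Subgroup G, A.Normal ∧ IsMulCommutative A ∧ A ≠ ⊥ := by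
  classical
  have hex : ∃ n, derivedSeries G n = ⊥ := Group.IsSolvable.solvable
  have hspec := Nat.find_spec hex
  obtain ⟨n, hn⟩ : ∃ n, Nat.find hex = n + 1 := by
    refine Nat.exists_eq_succ_of_ne_zero fun h => ?_
    rw [h, derivedSeries_zero] at hspec
    exact top_ne_bot hspec
  rw [hn, derivedSeries_succ, Subgroup.commutator_self_eq_bot_iff] at hspec
  exact ⟨derivedSeries G n, inferInstance, hspec, Nat.find_min hex (by lia)⟩

variable {G Ω : Type*} [Group G] [MulAction G Ω]

theorem isCancelSMul_of_isMulCommutative [FaithfulSMul G Ω] [IsPretransitive G Ω]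
    [IsMulCommutative G] : IsCancelSMul G Ω := by
  refine isCancelSMul_iff_eq_one_of_smul_eq.mpr fun a x hax => ?_
  refine FaithfulSMul.eq_of_smul_eq_smul (α := Ω) fun z => ?_
  obtain ⟨b, rfl⟩ := exists_smul_eq G x z
  rw [smul_smul, mul_comm', mul_smul, hax, one_smul]

theorem isPretransitive_of_normal_of_ne_bot [FaithfulSMul G Ω] [IsQuasiPreprimitive G Ω]
    {A : Subgroup G} [A.Normal] (hA : A ≠ ⊥) : IsPretransitive A Ω := by
  refine IsQuasiPreprimitive.isPretransitive_of_normal (G := G) fun h => hA ?_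
  refine (Subgroup.eq_bot_iff_forall A).mpr fun a ha => ?_
  refine FaithfulSMul.eq_of_smul_eq_smul (α := Ω) fun z => ?_
  have hz : z ∈ fixedPoints A Ω := h ▸ mem_univ z
  rw [one_smul]
  exact hz ⟨a, ha⟩

/- If `a` moves `x` to `y` inside a regular normal subgroup `A`, then so does `g * a * g⁻¹`, hence
`g` commutes with `a`; as `A` has prime order, it is generated by `a`. -/
theorem eq_one_of_isSolvable_of_prime_card [FaithfulSMul G Ω] [IsPretransitive G Ω]
    [Group.IsSolvable G] (hΩ : (Nat.card Ω).Prime) {g : G} {x y : Ω} (hxy : x ≠ y)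
    (hx : g • x = x) (hy : g • y = y) : g = 1 := by
  by_contra hg
  have : Nontrivial G := ⟨g, 1, hg⟩
  obtain ⟨A, hAnormal, hAcomm, hAbot⟩ := exists_normal_isMulCommutative_ne_bot G
  have := IsPreprimitive.of_prime_card (G := G) hΩ
  have := isPretransitive_of_normal_of_ne_bot (Ω := Ω) hAbot
  have := isCancelSMul_of_isMulCommutative (G := A) (Ω := Ω)
  have horbit : Function.Bijective fun a : A => a • x :=
    ⟨fun a b h => IsCancelSMul.right_cancel a b x h, exists_smul_eq A x⟩
  obtain ⟨a, ha⟩ := exists_smul_eq A x y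
  have hconj : g * a * g⁻¹ = a := by
    have h : (⟨g * a * g⁻¹, hAnormal.conj_mem a a.2 g⟩ : A) • x = a • x := by
      change (g * a * g⁻¹) • x = a • x
      rw [mul_smul, inv_smul_eq_iff.mpr hx.symm, mul_smul, ← Subgroup.smul_def, ha, hy]
    exact congrArg Subtype.val (horbit.1 h)
  have hcomm : Commute g a := mul_inv_eq_iff_eq_mul.mp hconj
  have : Fact (Nat.card Ω).Prime := ⟨hΩ⟩
  have hgen := zpowers_eq_top_of_prime_card (Nat.card_eq_of_bijective _ horbit)
    (g := a) fun h => hxy (by rw [← ha, h, one_smul])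
  refine hg (FaithfulSMul.eq_of_smul_eq_smul (α := Ω) fun z => ?_)
  obtain ⟨b, rfl⟩ := exists_smul_eq A x z
  obtain ⟨n, rfl⟩ := Subgroup.mem_zpowers_iff.mp (hgen ▸ Subgroup.mem_top b)
  rw [Subgroup.smul_def, Subgroup.coe_zpow, smul_smul, (hcomm.zpow_right n).eq, mul_smul, hx,
    one_smul]

end PrimeDegreeGroups

section GaloisPrimeDegree

open Polynomial Polynomial.Gal IntermediateField

variable {F K : Type*} [Field F] [CharZero F] [Field K] [Algebra F K] {f : F[X]}

theorem adjoin_pair_eq_top_of_isSolvable_gal (hf : Irreducible f) (hdeg : f.natDegree.Prime)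
    [Group.IsSolvable f.Gal] {a b : f.SplittingField} (hab : a ≠ b) (ha : aeval a f = 0)
    (hb : aeval b f = 0) : F⟮a, b⟯ = ⊤ := by
  have : IsGalois F f.SplittingField := .of_separable_splitting_field hf.separable
  have hcard : (Nat.card (f.rootSet f.SplittingField)).Prime := by
    rwa [Nat.card_eq_fintype_card, card_rootSet_eq_natDegree hf.separable (SplittingField.splits f)]
  have : MulAction.IsPretransitive f.Gal (f.rootSet f.SplittingField) := by
    refine ⟨fun x y => ?_⟩
    have hx := minpoly.eq_of_irreducible hf (mem_rootSet.mp x.2).2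
    have hy := minpoly.eq_of_irreducible hf (mem_rootSet.mp y.2).2
    obtain ⟨g, hg⟩ := (Normal.minpoly_eq_iff_mem_orbit f.SplittingField).mp (hy.symm.trans hx)
    exact ⟨g, Subtype.ext hg⟩
  have : FaithfulSMul f.Gal (f.rootSet f.SplittingField) :=
    ⟨fun h => Gal.ext f fun x hx => congrArg Subtype.val (h ⟨x, hx⟩)⟩
  have hroot : ∀ {r : f.SplittingField}, aeval r f = 0 → r ∈ f.rootSet f.SplittingField :=
    fun hr => mem_rootSet.mpr ⟨hf.ne_zero, hr⟩
  have hfix : F⟮a, b⟯.fixingSubgroup = ⊥ := by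
    refine (Subgroup.eq_bot_iff_forall _).mpr fun g hg => ?_
    have hg' := (IntermediateField.mem_fixingSubgroup_iff _ g).mp hg
    exact eq_one_of_isSolvable_of_prime_card (G := f.Gal) hcard (x := ⟨a, hroot ha⟩)
      (y := ⟨b, hroot hb⟩) (fun h => hab (congrArg Subtype.val h))
      (Subtype.ext (hg' a (subset_adjoin F _ (mem_insert a _))))
      (Subtype.ext (hg' b (subset_adjoin F _ (mem_insert_of_mem a rfl))))
  rw [← IsGalois.fixedField_fixingSubgroup F⟮a, b⟯, hfix, fixedField_bot]

theorem splits_of_isSolvable_gal_of_prime_natDegree (hf : Irreducible f) (hdeg : f.natDegree.Prime)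
    [Group.IsSolvable f.Gal] {a b : K} (hab : a ≠ b) (ha : aeval a f = 0) (hb : aeval b f = 0) :
    (f.map (algebraMap F K)).Splits := by
  let L := AlgebraicClosure K
  have hL : (f.map (algebraMap F L)).Splits := IsAlgClosed.splits _
  let φ : f.SplittingField →ₐ[F] L := SplittingField.lift f hL
  have hroot : ∀ {z : L}, aeval z f = 0 → ∃ w, aeval w f = 0 ∧ φ w = z := by
    intro z hz
    have hz' : z ∈ f.rootSet L := mem_rootSet.mpr ⟨hf.ne_zero, hz⟩
    rw [← (SplittingField.splits f).image_rootSet φ] at hz'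
    obtain ⟨w, hw, rfl⟩ := hz'
    exact ⟨w, (mem_rootSet.mp hw).2, rfl⟩
  have hlift : ∀ {r : K}, aeval r f = 0 → aeval (algebraMap K L r) f = 0 := fun hr => by
    rw [aeval_algebraMap_apply, hr, map_zero]
  obtain ⟨a', ha', haφ⟩ := hroot (hlift ha)
  obtain ⟨b', hb', hbφ⟩ := hroot (hlift hb)
  have hab' : a' ≠ b' := fun h =>
    hab ((algebraMap K L).injective (by rw [← haφ, ← hbφ, h]))
  have hrange : ∀ w, φ w ∈ (IsScalarTower.toAlgHom F K L).fieldRange := by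
    have hle : F⟮a', b'⟯ ≤ (IsScalarTower.toAlgHom F K L).fieldRange.comap φ := by
      rw [adjoin_le_iff]
      rintro _ (rfl | rfl)
      · exact ⟨a, haφ.symm⟩
      · exact ⟨b, hbφ.symm⟩
    rw [adjoin_pair_eq_top_of_isSolvable_gal hf hdeg hab' ha' hb'] at hle
    exact fun w => hle mem_top
  have hKL : (f.map (algebraMap F K)).map (algebraMap K L) = f.map (algebraMap F L) := by
    rw [Polynomial.map_map, ← IsScalarTower.algebraMap_eq F K L]
  refine Splits.of_splits_map_of_injective (algebraMap K L).injective (hKL ▸ hL) fun z hz => ?_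
  rw [hKL] at hz
  obtain ⟨w, -, rfl⟩ := hroot (mem_aroots.mp hz).2
  exact hrange w

end GaloisPrimeDegree

section PolynomialCriteria

open Polynomial

theorem one_lt_norm_of_sum_abs_coeff_lt {f : ℤ[X]}
    (hf : ∑ i ∈ Finset.range f.natDegree, |f.coeff (i + 1)| < |f.coeff 0|) {z : ℂ}
    (hz : aeval z f = 0) : 1 < ‖z‖ := by
  by_contra! hle
  have hsum : (f.coeff 0 : ℂ) =
      -∑ i ∈ Finset.range f.natDegree, (f.coeff (i + 1) : ℂ) * z ^ (i + 1) := by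
    rw [aeval_eq_sum_range, Finset.sum_range_succ'] at hz
    simp only [zsmul_eq_mul, pow_zero, mul_one] at hz
    linear_combination hz
  have hterm : ∀ i, ‖(f.coeff (i + 1) : ℂ) * z ^ (i + 1)‖ ≤ |(f.coeff (i + 1) : ℝ)| := fun i => by
    rw [norm_mul, norm_pow, Complex.norm_intCast]
    exact mul_le_of_le_one_right (abs_nonneg _) (pow_le_one₀ (norm_nonneg z) hle)
  have hbound : |(f.coeff 0 : ℝ)| ≤ ∑ i ∈ Finset.range f.natDegree, |(f.coeff (i + 1) : ℝ)| := by
    rw [← Complex.norm_intCast, hsum, norm_neg]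
    exact (norm_sum_le _ _).trans (Finset.sum_le_sum fun i _ => hterm i)
  exact hbound.not_gt (by exact_mod_cast hf)

theorem one_lt_multiset_prod {R : Type*} [CommSemiring R] [LinearOrder R] [IsStrictOrderedRing R]
    {m : Multiset R} (hm : m ≠ 0) (h : ∀ r ∈ m, 1 < r) : 1 < m.prod := by
  obtain ⟨r, hr⟩ := Multiset.exists_mem_of_ne_zero hm
  obtain ⟨m', rfl⟩ := Multiset.exists_cons_of_mem hr
  rw [Multiset.prod_cons]
  exact one_lt_mul_of_lt_of_le (h r hr)
    (Multiset.one_le_prod fun t ht => (h t (Multiset.mem_cons_of_mem ht)).le)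

theorem natDegree_eq_zero_of_isUnit_coeff_zero {g : ℤ[X]} (hg : IsUnit (g.coeff 0))
    (hroot : ∀ z : ℂ, aeval z g = 0 → 1 < ‖z‖) : g.natDegree = 0 := by
  set G := g.map (algebraMap ℤ ℂ)
  have hsplits : G.Splits := IsAlgClosed.splits G
  have hcoeff : ‖G.coeff 0‖ = 1 := by
    rw [coeff_map, algebraMap_int_eq, eq_intCast, Complex.norm_intCast]
    exact_mod_cast Int.isUnit_iff_abs_eq.mp hg
  have hG : G ≠ 0 := fun h => by simp [h] at hcoeff
  have hlead : 1 ≤ ‖G.leadingCoeff‖ := by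
    have h : g.leadingCoeff ≠ 0 := fun h => hG (by simp [G, leadingCoeff_eq_zero.mp h])
    rw [leadingCoeff_map_of_injective (algebraMap ℤ ℂ).injective_int, algebraMap_int_eq,
      eq_intCast, Complex.norm_intCast]
    exact_mod_cast Int.one_le_abs h
  by_contra hdeg
  have hprod : 1 < (G.roots.map norm).prod := by
    refine one_lt_multiset_prod (fun h => hdeg ?_) ?_
    · rw [← natDegree_map_eq_of_injective (algebraMap ℤ ℂ).injective_int,
        hsplits.natDegree_eq_card_roots, Multiset.map_eq_zero.mp h, Multiset.card_zero]
    · simp only [Multiset.mem_map, forall_exists_index, and_imp]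
      rintro _ z hz rfl
      exact hroot z (mem_aroots.mp hz).2
  have hnormprod : ‖G.roots.prod‖ = (G.roots.map norm).prod :=
    map_multiset_prod (normHom : ℂ →*₀ ℝ) G.roots
  rw [hsplits.coeff_zero_eq_leadingCoeff_mul_prod_roots] at hcoeff
  simp only [norm_mul, norm_pow, norm_neg, norm_one, one_pow, one_mul, hnormprod] at hcoeff
  exact (one_lt_mul_of_le_of_lt hlead hprod).ne' hcoeff

theorem irreducible_of_prime_coeff_zero {f : ℤ[X]} (hprime : Prime (f.coeff 0))
    (hf : ∑ i ∈ Finset.range f.natDegree, |f.coeff (i + 1)| < |f.coeff 0|) : Irreducible f := by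
  have hunit : ∀ {g : ℤ[X]}, g ∣ f → IsUnit (g.coeff 0) → IsUnit g := fun {g} hgf hg => by
    have hdeg := natDegree_eq_zero_of_isUnit_coeff_zero hg fun z hz =>
      one_lt_norm_of_sum_abs_coeff_lt hf (zero_dvd_iff.mp (hz ▸ map_dvd (aeval z) hgf))
    rw [eq_C_of_natDegree_eq_zero hdeg]
    exact isUnit_C.mpr hg
  refine ⟨fun h => hprime.not_isUnit ?_, fun g h hgh => ?_⟩
  · simpa using h.map constantCoeff
  · have hmul := congrArg (coeff · 0) hgh
    simp only [mul_coeff_zero] at hmul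
    exact (hprime.irreducible.isUnit_or_isUnit hmul).imp (hunit ⟨h, hgh⟩)
      (hunit (Dvd.intro_left g hgh.symm))

theorem two_mul_coeff_zero_mul_coeff_two_le_of_splits {K : Type*} [Field K] [LinearOrder K]
    [IsStrictOrderedRing K] {f : K[X]} (hf : f.Splits) :
    2 * f.coeff 0 * f.coeff 2 ≤ f.coeff 1 ^ 2 := by
  have hprod : ∀ m : Multiset K, 2 * (m.map (X - C ·)).prod.coeff 0 *
      (m.map (X - C ·)).prod.coeff 2 ≤ (m.map (X - C ·)).prod.coeff 1 ^ 2 := by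
    intro m
    induction m using Multiset.induction_on with
    | empty => simp [coeff_one]
    | cons r m ih =>
      simp only [Multiset.map_cons, Multiset.prod_cons, sub_mul, coeff_sub, coeff_C_mul,
        coeff_X_mul_zero, coeff_X_mul]
      linear_combination r ^ 2 * ih +
        sq_nonneg ((m.map (X - C ·)).prod.coeff 0)
  rw [hf.eq_prod_roots]
  simp only [coeff_C_mul]
  linear_combination f.leadingCoeff ^ 2 * hprod f.roots

end PolynomialCriteria

section Primality

theorem lucas_primality_of_dvd_prod_pow {n k : ℕ} (a : ZMod n) (l : List ℕ)
    (hl : ∀ q ∈ l, q.Prime) (hdvd : n - 1 ∣ l.prod ^ k) (ha : a ^ (n - 1) = 1)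
    (hne : ∀ q ∈ l, a ^ ((n - 1) / q) ≠ 1) : n.Prime := by
  refine lucas_primality n a ha fun q hq hqn => ?_
  obtain ⟨r, hr, hqr⟩ := hq.prime.dvd_prod_iff.mp (hq.dvd_of_dvd_pow (hqn.trans hdvd))
  rw [(Nat.prime_dvd_prime_iff_eq hq (hl r hr)).mp hqr]
  exact hne r hr

theorem prime_318931181 : Nat.Prime 318931181 := by
  apply lucas_primality_of_dvd_prod_pow (k := 2) 2 [2, 5, 61, 197, 1327] <;> norm_num <;>
    reduce_mod_char
  decide

theorem prime_832016366747009 : Nat.Prime 832016366747009 := by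
  apply lucas_primality_of_dvd_prod_pow (k := 7) 3 [2, 131, 48973, 1013197] <;> norm_num <;>
    reduce_mod_char
  decide

theorem prime_470741477400408105034453847 : Nat.Prime 470741477400408105034453847 := by
  apply lucas_primality_of_dvd_prod_pow (k := 1) 5 [2, 887, 318931181, 832016366747009]
  · simp only [List.forall_mem_cons, prime_318931181, prime_832016366747009]
    norm_num
  all_goals norm_num <;> reduce_mod_char
  decide

end Primality

section RefractionPolynomial

open Polynomial

/-- The irreducible polynomial of `(9 * W - 407) / 2`, where the refracted ray from `(27, 2)` to
`(-1, -6)` for the weight `7 / 5` has `p ^ 2 = (49 + W) / 50`. The affine change of variable makes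
the constant coefficient a prime that exceeds the sum of the other coefficients. -/
noncomputable def refractionPoly : ℤ[X] :=
  42406625 * X ^ 11 + 61143514690 * X ^ 10 + 37893177458102 * X ^ 9 + 13107919256264283 * X ^ 8 +
    2742828241646104230 * X ^ 7 + 349930746377343352824 * X ^ 6 +
    25776329658405451707192 * X ^ 5 + 932586008799534902449662 * X ^ 4 +
    10146223118501579882658561 * X ^ 3 + 63868416502729838732356214 * X ^ 2 +
    192413336346232605887273770 * X + 470741477400408105034453847

theorem natDegree_refractionPoly : refractionPoly.natDegree = 11 := by
  unfold refractionPoly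
  compute_degree!

theorem irreducible_refractionPoly : Irreducible refractionPoly := by
  apply irreducible_of_prime_coeff_zero
  · simpa [refractionPoly, coeff_X] using
      Nat.prime_iff_prime_int.mp prime_470741477400408105034453847
  · rw [natDegree_refractionPoly]
    simp [refractionPoly, Finset.sum_range_succ, coeff_X, coeff_X_pow]

theorem not_splits_refractionPoly : ¬ (refractionPoly.map (Int.castRingHom ℝ)).Splits := by
  intro h
  have hle := two_mul_coeff_zero_mul_coeff_two_le_of_splits h
  norm_num [refractionPoly, coeff_X, coeff_X_pow] at hle

theorem aeval_refractionPoly (x : ℝ) : aeval x refractionPoly =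
    42406625 * x ^ 11 + 61143514690 * x ^ 10 + 37893177458102 * x ^ 9 +
      13107919256264283 * x ^ 8 + 2742828241646104230 * x ^ 7 + 349930746377343352824 * x ^ 6 +
      25776329658405451707192 * x ^ 5 + 932586008799534902449662 * x ^ 4 +
      10146223118501579882658561 * x ^ 3 + 63868416502729838732356214 * x ^ 2 +
      192413336346232605887273770 * x + 470741477400408105034453847 := by
  simp only [refractionPoly, map_add, map_mul, map_pow, aeval_X, map_ofNat]

theorem exists_root_refractionPoly_lt : ∃ x < (-204 : ℝ), aeval x refractionPoly = 0 := by
  have hcont : ContinuousOn (fun x : ℝ => aeval x refractionPoly) (Icc (-206) (-204)) :=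
    (Polynomial.continuous_aeval _).continuousOn
  obtain ⟨x, hx, hx0⟩ := intermediate_value_Ioo' (by norm_num) hcont
    (show (0 : ℝ) ∈ Ioo _ _ by simp only [aeval_refractionPoly]; norm_num)
  exact ⟨x, hx.2, hx0⟩

theorem not_ACMComputable_of_aeval_refractionPoly_eq_zero {x : ℝ} (hx : -204 ≤ x)
    (hroot : aeval x refractionPoly = 0) : ¬ ACMComputable x := by
  intro hcomp
  obtain ⟨y, hy, hyroot⟩ := exists_root_refractionPoly_lt
  have hdeg : refractionPoly.natDegree ≠ 0 := by simp [natDegree_refractionPoly]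
  have hirr : Irreducible (refractionPoly.map (algebraMap ℤ ℚ)) :=
    (irreducible_refractionPoly.isPrimitive hdeg).irreducible_iff_irreducible_map_fraction_map.mp
      irreducible_refractionPoly
  have hprime : (refractionPoly.map (algebraMap ℤ ℚ)).natDegree.Prime := by
    rw [natDegree_map_eq_of_injective (algebraMap ℤ ℚ).injective_int, natDegree_refractionPoly]
    norm_num
  have hrootC : aeval (x : ℂ) (refractionPoly.map (algebraMap ℤ ℚ)) = 0 := by
    rw [aeval_map_algebraMap, ← Complex.coe_algebraMap, aeval_algebraMap_apply, hroot, map_zero]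
  have := isSolvable_gal_of_irreducible hcomp hirr hrootC
  have hsplits := splits_of_isSolvable_gal_of_prime_natDegree (K := ℝ) hirr hprime
    (hy.trans_le hx).ne (by rwa [aeval_map_algebraMap]) (by rwa [aeval_map_algebraMap])
  rw [Polynomial.map_map, ← IsScalarTower.algebraMap_eq] at hsplits
  exact not_splits_refractionPoly hsplits

/- A relation between four square roots `a, b, c, d`, freed from radicals by squaring twice. -/
theorem sq_eq_of_add_add_add_eq_zero {R : Type*} [CommRing R] {a b c d A B C D : R}
    (h : a + b + c + d = 0) (hA : a ^ 2 = A) (hB : b ^ 2 = B) (hC : c ^ 2 = C) (hD : d ^ 2 = D) :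
    ((A + B - C - D) ^ 2 - 4 * A * B - 4 * C * D) ^ 2 = 64 * A * B * C * D := by
  subst hA hB hC hD
  rw [show d = -(a + b + c) by linear_combination h]
  ring

theorem aeval_refractionPoly_eq_zero {p q P Q W : ℝ} (hp : 0 < p) (hq : 0 < q) (hP : 0 < P)
    (hQ : 0 < Q) (hpW : p ^ 2 = (49 + W) / 50) (hqW : q ^ 2 = (49 - W) / 50)
    (hPW : P ^ 2 = (1 - W) / 50) (hQW : Q ^ 2 = (1 + W) / 50) (hW : W ≠ 0)
    (hsnell : 27 / p - 2 / P = 6 / q - 1 / Q) : aeval ((9 * W - 407) / 2) refractionPoly = 0 := by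
  have hsum : 27 * (q * P * Q) + -2 * (p * q * Q) + -6 * (p * P * Q) + p * q * P = 0 := by
    field_simp at hsnell
    linear_combination hsnell
  have helim := sq_eq_of_add_add_add_eq_zero hsum rfl rfl rfl rfl
  simp only [mul_pow, hpW, hqW, hPW, hQW] at helim
  refine (mul_eq_zero_iff_left hW).mp ?_
  rw [aeval_refractionPoly]
  linear_combination ((9 / 2) ^ 11 * 50 ^ 12 / 8192) * helim

end RefractionPolynomial

section WeightedLength

open MeasureTheory

variable {R : Set Plane} {α : ℝ}

theorem regionWeight_of_mem_interior {x : Plane} (hx : x ∈ interior R) :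
    regionWeight R α x = α :=
  if_pos hx

theorem regionWeight_of_notMem_interior (hα : 1 ≤ α) {x : Plane} (hx : x ∉ interior R) :
    regionWeight R α x = 1 := by
  rw [regionWeight, if_neg hx, min_eq_left hα, ite_self]

theorem one_le_regionWeight (hα : 1 ≤ α) (x : Plane) : 1 ≤ regionWeight R α x := by
  by_cases hx : x ∈ interior R
  · exact hα.trans_eq (regionWeight_of_mem_interior hx).symm
  · exact (regionWeight_of_notMem_interior hα hx).ge

theorem norm_regionWeight_le (x : Plane) : ‖regionWeight R α x‖ ≤ max 1 |α| := by
  unfold regionWeight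
  split_ifs
  · exact le_max_right _ _
  · rw [Real.norm_eq_abs]
    exact (abs_min_le_max_abs_abs).trans_eq (by rw [abs_one])
  · exact (norm_one).trans_le (le_max_left _ _)

theorem measurable_regionWeight (R : Set Plane) (α : ℝ) : Measurable (regionWeight R α) := by
  classical
  exact .ite isOpen_interior.measurableSet measurable_const
    (.ite isClosed_frontier.measurableSet measurable_const measurable_const)

/-- The weighted length of the arc of `γ` over the parameter interval `[a, b]`. -/
noncomputable def arcLength (R : Set Plane) (α : ℝ) (γ : ℝ → Plane) (a b : ℝ) : ℝ :=
  ∫ τ in a..b, regionWeight R α (γ τ) * ‖deriv γ τ‖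

theorem arcLength_zero_one (γ : ℝ → Plane) : arcLength R α γ 0 1 = weightedLength R α γ := rfl

variable {γ γ₁ γ₂ : ℝ → Plane} {a b c : ℝ}

theorem intervalIntegrable_regionWeight_mul_norm_deriv (hab : a ≤ b) {K : NNReal}
    (hγ : LipschitzOnWith K γ (Icc a b)) :
    IntervalIntegrable (fun τ => regionWeight R α (γ τ) * ‖deriv γ τ‖) volume a b := by
  rw [intervalIntegrable_iff_integrableOn_Ioo_of_le hab]
  refine Integrable.of_bound (C := max 1 |α| * K) ?_ ?_
  · have hcont := (hγ.continuousOn.mono Ioo_subset_Icc_self).aemeasurable (μ := volume)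
      measurableSet_Ioo
    exact (((measurable_regionWeight R α).comp_aemeasurable hcont).mul
      (measurable_deriv γ).norm.aemeasurable).aestronglyMeasurable
  · filter_upwards [ae_restrict_mem measurableSet_Ioo] with τ hτ
    rw [norm_mul, norm_norm]
    exact mul_le_mul (norm_regionWeight_le _)
      (norm_deriv_le_of_lipschitzOn (Icc_mem_nhds hτ.1 hτ.2) hγ) (norm_nonneg _) (by positivity)

theorem arcLength_add_arcLength (hab : a ≤ b) (hbc : b ≤ c) {K : NNReal}
    (hγ : LipschitzOnWith K γ (Icc a c)) :
    arcLength R α γ a b + arcLength R α γ b c = arcLength R α γ a c :=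
  intervalIntegral.integral_add_adjacent_intervals
    (intervalIntegrable_regionWeight_mul_norm_deriv hab (hγ.mono (Icc_subset_Icc_right hbc)))
    (intervalIntegrable_regionWeight_mul_norm_deriv hbc (hγ.mono (Icc_subset_Icc_left hab)))

theorem arcLength_congr (hab : a ≤ b) (h : EqOn γ₁ γ₂ (Ioo a b)) :
    arcLength R α γ₁ a b = arcLength R α γ₂ a b := by
  simp only [arcLength, intervalIntegral.integral_of_le hab, integral_Ioc_eq_integral_Ioo]
  refine setIntegral_congr_fun measurableSet_Ioo fun τ hτ => ?_
  have hderiv := (h.eventuallyEq_of_mem (isOpen_Ioo.mem_nhds hτ)).deriv_eq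
  simp only [h hτ, hderiv]

theorem arcLength_comp_mul_sub (γ : ℝ → Plane) (hc : 0 < c) (d : ℝ) :
    arcLength R α (fun τ => γ (c * τ - d)) a b = arcLength R α γ (c * a - d) (c * b - d) := by
  have hderiv : ∀ τ, deriv (fun τ => γ (c * τ - d)) τ = c • deriv γ (c * τ - d) := fun τ => by
    rw [deriv_comp_mul_left c (fun τ => γ (τ - d)), deriv_comp_sub_const]
  simp only [arcLength, hderiv, norm_smul, Real.norm_of_nonneg hc.le, mul_left_comm _ c,
    intervalIntegral.integral_const_mul]
  exact intervalIntegral.mul_integral_comp_mul_sub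
    (f := fun τ => regionWeight R α (γ τ) * ‖deriv γ τ‖) c d

theorem arcLength_lineMap_of_forall_eq (hab : a ≤ b) {x y : Plane} {w : ℝ}
    (hw : ∀ τ ∈ Ioo a b, regionWeight R α (AffineMap.lineMap x y τ) = w) :
    arcLength R α (fun τ => AffineMap.lineMap x y τ) a b = (b - a) * (w * ‖y - x‖) := by
  rw [arcLength, intervalIntegral.integral_of_le hab, integral_Ioc_eq_integral_Ioo,
    setIntegral_congr_fun (g := fun _ => w * ‖y - x‖) measurableSet_Ioo fun τ hτ => by
      simp only [hw τ hτ, AffineMap.hasDerivAt_lineMap.deriv]]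
  simp [hab]

end WeightedLength

section PathConcatenation

/-- The path that traverses `γ₁` and then a translate of `γ₂`, each at double speed. -/
noncomputable def concatPath (γ₁ γ₂ : ℝ → Plane) (τ : ℝ) : Plane :=
  γ₁ (min (2 * τ) 1) + (γ₂ (max (2 * τ - 1) 0) - γ₂ 0)

variable {R : Set Plane} {α : ℝ} {x y z : Plane} {γ₁ γ₂ : ℝ → Plane}

theorem isPathFromTo_lineMap (x y : Plane) :
    IsPathFromTo x y (fun τ => AffineMap.lineMap x y τ) :=
  ⟨⟨_, (lipschitzWith_lineMap x y).lipschitzOnWith⟩, by simp, by simp⟩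

theorem IsPathFromTo.concat (h₁ : IsPathFromTo x y γ₁) (h₂ : IsPathFromTo y z γ₂) :
    IsPathFromTo x z (concatPath γ₁ γ₂) := by
  obtain ⟨⟨K₁, hK₁⟩, hx, hy⟩ := h₁
  obtain ⟨⟨K₂, hK₂⟩, hy', hz⟩ := h₂
  have hdouble : LipschitzWith 2 fun τ : ℝ => 2 * τ := by
    simpa using lipschitzWith_smul (2 : ℝ) (β := ℝ)
  refine ⟨⟨_, (hK₁.comp ((hdouble.min_const 1).lipschitzOnWith) ?_).add
    ((hK₂.comp (((hdouble.sub (.const 1)).max_const 0).lipschitzOnWith) ?_).sub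
      (LipschitzWith.const _).lipschitzOnWith)⟩, ?_, ?_⟩
  · exact fun τ hτ => ⟨le_min (by linarith [hτ.1]) zero_le_one, min_le_right _ _⟩
  · exact fun τ hτ => ⟨le_max_right _ _, max_le (by linarith [hτ.2]) zero_le_one⟩
  · simp [concatPath, hx]
  · norm_num [concatPath, hy, hy', hz]

theorem weightedLength_concatPath (h₁ : IsPathFromTo x y γ₁) (h₂ : IsPathFromTo y z γ₂) :
    weightedLength R α (concatPath γ₁ γ₂) = weightedLength R α γ₁ + weightedLength R α γ₂ := by
  obtain ⟨⟨K, hK⟩, -, -⟩ := h₁.concat h₂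
  have hfirst : EqOn (concatPath γ₁ γ₂) (fun τ => γ₁ (2 * τ - 0)) (Ioo 0 (1 / 2)) := fun τ hτ => by
    simp only [concatPath, sub_zero]
    rw [min_eq_left (by linarith [hτ.2]), max_eq_right (by linarith [hτ.2]), sub_self, add_zero]
  have hsecond : EqOn (concatPath γ₁ γ₂) (fun τ => γ₂ (2 * τ - 1)) (Ioo (1 / 2) 1) := fun τ hτ => by
    simp only [concatPath]
    rw [min_eq_right (by linarith [hτ.1]), max_eq_left (by linarith [hτ.1]), h₁.2.2, h₂.2.1,
      add_sub_cancel]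
  rw [← arcLength_zero_one, ← arcLength_add_arcLength (b := 1 / 2) (by norm_num) (by norm_num) hK,
    arcLength_congr (by norm_num) hfirst, arcLength_congr (by norm_num) hsecond,
    arcLength_comp_mul_sub γ₁ two_pos, arcLength_comp_mul_sub γ₂ two_pos]
  norm_num [arcLength_zero_one]

theorem exists_isPathFromTo_weightedLength_eq_chainLength {t : Plane} :
    ∀ (l : List Plane) (x : Plane), (x :: l).getLast? = some t →
      ∃ γ, IsPathFromTo x t γ ∧ weightedLength R α γ = chainLength R α (x :: l)
  | [], x, ht => by
    obtain rfl : x = t := by simpa using ht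
    exact ⟨_, isPathFromTo_lineMap x x, by simp [weightedLength, chainLength]⟩
  | y :: l, x, ht => by
    obtain ⟨γ, hγ, hlen⟩ :=
      exists_isPathFromTo_weightedLength_eq_chainLength l y (by simpa using ht)
    have hxy := isPathFromTo_lineMap x y
    exact ⟨_, hxy.concat hγ, by rw [weightedLength_concatPath hxy hγ, hlen, chainLength]⟩

theorem IsShortestChain.chainLength_le {s t : Plane} {L l : List Plane}
    (hL : IsShortestChain R α s t L) (hl : (s :: l).getLast? = some t) :
    chainLength R α L ≤ chainLength R α (s :: l) := by
  obtain ⟨γ, hγ, hlen⟩ := exists_isPathFromTo_weightedLength_eq_chainLength (R := R) (α := α) l s hl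
  exact hlen ▸ hL.le_length γ hγ

end PathConcatenation

section Calibration

/-- `φ` is a calibration: it grows along every Lipschitz arc by at most the weighted length of the
arc, so that its increments bound weighted lengths from below. The condition is on arcs and not
only on whole paths, so that tightness of a path passes to its initial arcs. -/
def Calibrates (R : Set Plane) (α : ℝ) (φ : Plane → ℝ) : Prop :=
  ∀ (γ : ℝ → Plane) (a b : ℝ), a ≤ b → (∃ K, LipschitzOnWith K γ (Icc a b)) →
    φ (γ b) - φ (γ a) ≤ arcLength R α γ a b

namespace Calibrates

variable {R : Set Plane} {α : ℝ} {φ : Plane → ℝ} {s t : Plane}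

theorem sub_le_weightedLength (h : Calibrates R α φ) {γ : ℝ → Plane} (hγ : IsPathFromTo s t γ) :
    φ t - φ s ≤ weightedLength R α γ := by
  obtain ⟨hlip, rfl, rfl⟩ := hγ
  exact h γ 0 1 zero_le_one hlip

theorem sub_le_chainLength (h : Calibrates R α φ) :
    ∀ (l : List Plane) (x : Plane), (x :: l).getLast? = some t →
      φ t - φ x ≤ chainLength R α (x :: l)
  | [], x, ht => by
    obtain rfl : x = t := by simpa using ht
    simp [chainLength]
  | y :: l, x, ht => by
    have htail := h.sub_le_chainLength l y (by simpa using ht)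
    have hhead := h.sub_le_weightedLength (isPathFromTo_lineMap x y)
    rw [chainLength]
    linarith

theorem isShortestChain (h : Calibrates R α φ) {L : List Plane} (hhead : L.head? = some s)
    (hlast : L.getLast? = some t) (hL : chainLength R α L ≤ φ t - φ s) :
    IsShortestChain R α s t L :=
  ⟨hhead, hlast, fun _ hγ => hL.trans (h.sub_le_weightedLength hγ)⟩

theorem exists_tight_segment (h : Calibrates R α φ) (hst : s ≠ t) :
    ∀ l : List Plane, (s :: l).getLast? = some t → chainLength R α (s :: l) ≤ φ t - φ s →
      ∃ v ∈ l, v ≠ s ∧ weightedLength R α (fun τ => AffineMap.lineMap s v τ) ≤ φ v - φ s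
  | [], ht, _ => absurd (by simpa using ht) hst
  | y :: l, ht, hl => by
    rw [chainLength] at hl
    have hlast : (y :: l).getLast? = some t := by simpa using ht
    have htail := h.sub_le_chainLength l y hlast
    by_cases hy : y = s
    · rw [hy] at hl hlast htail
      have hhead := h.sub_le_weightedLength (isPathFromTo_lineMap s s)
      obtain ⟨v, hv, hv'⟩ := h.exists_tight_segment hst l hlast (by linarith)
      exact ⟨v, List.mem_cons_of_mem _ hv, hv'⟩
    · exact ⟨y, List.mem_cons_self, hy, by linarith⟩

theorem sameRay_of_tight_segment (h : Calibrates R α φ) {U : Set Plane} (hU : U ∈ nhds s)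
    {g : Plane} (hg : ∀ z ∈ U, regionWeight R α z = ‖g‖)
    (hφ : ∀ z ∈ U, φ z = φ s + inner ℝ g (z - s)) {v : Plane}
    (hv : weightedLength R α (fun τ => AffineMap.lineMap s v τ) ≤ φ v - φ s) :
    SameRay ℝ g (v - s) := by
  obtain ⟨δ, ⟨hδ0, hδ1⟩, hδU⟩ : ∃ δ : ℝ, δ ∈ Ioc 0 1 ∧
      ∀ τ ∈ Icc 0 δ, AffineMap.lineMap s v τ ∈ U := by
    have hcont : Filter.Tendsto (fun τ : ℝ => AffineMap.lineMap s v τ) (nhds 0) (nhds s) :=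
      AffineMap.lineMap_continuous.tendsto' _ _ (AffineMap.lineMap_apply_zero s v)
    obtain ⟨ε, hε, hεU⟩ := Metric.eventually_nhds_iff.mp (hcont.eventually hU)
    refine ⟨min (ε / 2) 1, ⟨by positivity, min_le_right _ _⟩, fun τ hτ => hεU ?_⟩
    rw [Real.dist_0_eq_abs, abs_of_nonneg hτ.1]
    linarith [hτ.2.trans (min_le_left _ _)]
  have hlip := (lipschitzWith_lineMap (𝕜 := ℝ) s v).lipschitzOnWith (s := Icc 0 1)
  have hnear : arcLength R α (fun τ => AffineMap.lineMap s v τ) 0 δ = δ * (‖g‖ * ‖v - s‖) := by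
    rw [arcLength_lineMap_of_forall_eq hδ0.le fun τ hτ => hg _ (hδU τ (Ioo_subset_Icc_self hτ)),
      sub_zero]
  have hfar := h (fun τ => AffineMap.lineMap s v τ) δ 1 hδ1
    ⟨_, hlip.mono (Icc_subset_Icc_left hδ0.le)⟩
  have hφδ : φ (AffineMap.lineMap s v δ) = φ s + δ * inner ℝ g (v - s) := by
    rw [hφ _ (hδU δ (right_mem_Icc.mpr hδ0.le)), AffineMap.lineMap_apply, vsub_eq_sub, vadd_eq_add,
      add_sub_cancel_right, real_inner_smul_right]
  rw [← arcLength_zero_one, ← arcLength_add_arcLength hδ0.le hδ1 hlip, hnear] at hv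
  simp only [AffineMap.lineMap_apply_one, hφδ] at hfar
  have hle : ‖g‖ * ‖v - s‖ ≤ inner ℝ g (v - s) :=
    le_of_mul_le_mul_left (by linarith) hδ0
  rw [sameRay_iff_norm_smul_eq]
  exact (inner_eq_norm_mul_iff_real.mp (le_antisymm (real_inner_le_norm _ _) hle)).symm

end Calibrates

end Calibration

section Corner

theorem interior_preimage_coord (i : Fin 2) (S : Set ℝ) :
    interior {x : Plane | x i ∈ S} = {x : Plane | x i ∈ interior S} := by
  have hopen : IsOpenMap fun x : Plane => x i :=
    (isOpenMap_eval i).comp (PiLp.homeomorph 2 _).isOpenMap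
  exact (hopen.preimage_interior_eq_interior_preimage (by fun_prop) S).symm

theorem interior_quadrant (O : Plane) :
    interior (quadrant O) = {x | O 0 < x 0 ∧ x 1 < O 1} := by
  have hinter : quadrant O = {x | x 0 ∈ Ici (O 0)} ∩ {x | x 1 ∈ Iic (O 1)} := rfl
  rw [hinter, interior_inter, interior_preimage_coord, interior_preimage_coord, interior_Ici,
    interior_Iic]
  rfl

theorem interior_rectangle (A B : Plane) :
    interior (rectangle A B) = {x | (A 0 < x 0 ∧ x 0 < B 0) ∧ A 1 < x 1 ∧ x 1 < B 1} := by
  have hinter : rectangle A B = {x | x 0 ∈ Icc (A 0) (B 0)} ∩ {x | x 1 ∈ Icc (A 1) (B 1)} :=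
    ext fun _ => and_assoc.symm
  rw [hinter, interior_inter, interior_preimage_coord, interior_preimage_coord, interior_Icc,
    interior_Icc]
  rfl

/-- `R` looks like the fourth quadrant near the origin: it lies in this quadrant and contains the
square of side length `M` at its corner. -/
structure HasCorner (M : ℝ) (R : Set Plane) : Prop where
  square_subset : rectangle !₂[0, -M] !₂[M, 0] ⊆ R
  subset_quadrant : R ⊆ quadrant 0

namespace HasCorner

variable {M : ℝ} {R : Set Plane} {x : Plane}

theorem mem_interior (hR : HasCorner M R) (hx : x 0 ∈ Ioo 0 M) (hx' : x 1 ∈ Ioo (-M) 0) :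
    x ∈ interior R :=
  interior_mono hR.square_subset (by rw [interior_rectangle]; exact ⟨hx, hx'⟩)

theorem pos_and_neg_of_mem_interior (hR : HasCorner M R) (hx : x ∈ interior R) :
    0 < x 0 ∧ x 1 < 0 := by
  have hmem := interior_mono hR.subset_quadrant hx
  rwa [interior_quadrant] at hmem

theorem notMem_of_pos (hR : HasCorner M R) (hx : 0 < x 1) : x ∉ R := fun hmem =>
  (hR.subset_quadrant hmem).2.not_gt hx

theorem notMem_of_neg (hR : HasCorner M R) (hx : x 0 < 0) : x ∉ R := fun hmem =>
  (hR.subset_quadrant hmem).1.not_gt hx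

end HasCorner

end Corner

section Ramp

variable {h : ℝ → ℝ} {h' τ : ℝ}

theorem hasDerivAt_max_zero_of_nonpos (hτ : h τ ≤ 0)
    (hmax : DifferentiableAt ℝ (fun s => max (h s) 0) τ) :
    HasDerivAt (fun s => max (h s) 0) 0 τ := by
  have hmin : IsLocalMin (fun s => max (h s) 0) τ :=
    Filter.Eventually.of_forall fun s => (max_eq_right hτ).trans_le (le_max_right _ _)
  simpa only [hmin.deriv_eq_zero] using hmax.hasDerivAt

theorem hasDerivAt_max_zero_of_nonneg (hτ : 0 ≤ h τ) (hh : HasDerivAt h h' τ)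
    (hmax : DifferentiableAt ℝ (fun s => max (h s) 0) τ) :
    HasDerivAt (fun s => max (h s) 0) h' τ := by
  have hmin : IsLocalMin (fun s => max (h s) 0 - h s) τ :=
    Filter.Eventually.of_forall fun s => by simp [max_eq_left hτ]
  have hderiv := hmin.hasDerivAt_eq_zero (hmax.hasDerivAt.sub hh)
  exact sub_eq_zero.mp hderiv ▸ hmax.hasDerivAt

/-- The continuous piecewise linear function that vanishes at `0` and has slope `a` on the negative
half-line, slope `b` between `0` and `M`, and slope `0` beyond `M`. -/
def ramp (a b M x : ℝ) : ℝ := a * x + (b - a) * max x 0 - b * max (x - M) 0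

/-- The derivative of `ramp a b M`, with an arbitrary choice of one-sided derivatives at the two
corners. -/
noncomputable def rampSlope (a b M x : ℝ) : ℝ := if x ≤ 0 then a else if x < M then b else 0

variable {a b M x : ℝ}

theorem ramp_of_nonpos (hM : 0 ≤ M) (hx : x ≤ 0) : ramp a b M x = a * x := by
  rw [ramp, max_eq_right hx, max_eq_right (by linarith)]
  ring

theorem ramp_of_mem_Icc (hx : x ∈ Icc 0 M) : ramp a b M x = b * x := by
  rw [ramp, max_eq_left hx.1, max_eq_right (by linarith [hx.2])]
  ring

theorem hasDerivAt_ramp_comp (hM : 0 < M) (hh : HasDerivAt h h' τ)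
    (h0 : DifferentiableAt ℝ (fun s => max (h s) 0) τ)
    (hM' : DifferentiableAt ℝ (fun s => max (h s - M) 0) τ) :
    HasDerivAt (fun s => ramp a b M (h s)) (rampSlope a b M (h τ) * h') τ := by
  have hderiv : ∀ {e e'}, HasDerivAt (fun s => max (h s) 0) e τ →
      HasDerivAt (fun s => max (h s - M) 0) e' τ →
      HasDerivAt (fun s => ramp a b M (h s)) (a * h' + (b - a) * e - b * e') τ :=
    fun he he' => ((hh.const_mul a).add (he.const_mul (b - a))).sub (he'.const_mul b)
  have hhM := hh.sub_const M
  unfold rampSlope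
  split_ifs with hneg hlt
  · convert hderiv (hasDerivAt_max_zero_of_nonpos hneg h0)
      (hasDerivAt_max_zero_of_nonpos (by linarith) hM') using 1
    ring
  · convert hderiv (hasDerivAt_max_zero_of_nonneg (not_le.mp hneg).le hh h0)
      (hasDerivAt_max_zero_of_nonpos (by linarith) hM') using 1
    ring
  · convert hderiv (hasDerivAt_max_zero_of_nonneg (not_le.mp hneg).le hh h0)
      (hasDerivAt_max_zero_of_nonneg (by linarith) hhM hM') using 1
    ring

variable {K : NNReal} {c d : ℝ}

theorem absolutelyContinuousOnInterval_max_zero (hcd : c ≤ d)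
    (hh : LipschitzOnWith K h (Icc c d)) :
    AbsolutelyContinuousOnInterval (fun τ => max (h τ) 0) c d :=
  LipschitzOnWith.absolutelyContinuousOnInterval (uIcc_of_le hcd ▸
    (LipschitzWith.id.max_const 0).comp_lipschitzOnWith hh)

theorem absolutelyContinuousOnInterval_ramp_comp (hcd : c ≤ d)
    (hh : LipschitzOnWith K h (Icc c d)) :
    AbsolutelyContinuousOnInterval (fun τ => ramp a b M (h τ)) c d := by
  have hlin := LipschitzOnWith.absolutelyContinuousOnInterval (uIcc_of_le hcd ▸ hh)
  have h0 := absolutelyContinuousOnInterval_max_zero hcd hh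
  have hM := absolutelyContinuousOnInterval_max_zero hcd
    (hh.sub (LipschitzWith.const M).lipschitzOnWith)
  exact ((hlin.const_mul a).add (h0.const_mul (b - a))).sub (hM.const_mul b)

theorem ae_hasDerivAt_ramp_comp (hM : 0 < M) (hcd : c ≤ d) (hh : LipschitzOnWith K h (Icc c d)) :
    ∀ᵐ τ, τ ∈ Icc c d → ∀ h', HasDerivAt h h' τ →
      HasDerivAt (fun s => ramp a b M (h s)) (rampSlope a b M (h τ) * h') τ := by
  have h0 := absolutelyContinuousOnInterval_max_zero hcd hh
  have hM' := absolutelyContinuousOnInterval_max_zero hcd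
    (hh.sub (LipschitzWith.const M).lipschitzOnWith)
  filter_upwards [h0.ae_differentiableAt, hM'.ae_differentiableAt] with τ h0τ hMτ hτ h' hh'
  rw [uIcc_of_le hcd] at h0τ hMτ
  exact hasDerivAt_ramp_comp hM hh' (h0τ hτ) (hMτ hτ)

end Ramp

section RefractionPotential

open MeasureTheory

variable {R : Set Plane} {α p q P Q M : ℝ}

/-- The conserved quantities of a ray that enters a region of weight `α` through a horizontal side
and leaves it through a vertical one: by Snell's law, it has direction `-(p, P)` before the region,
`-(p, q)` inside and `-(Q, q)` behind it. -/
structure IsRefraction (α p q P Q : ℝ) : Prop where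
  p_pos : 0 < p
  q_pos : 0 < q
  P_pos : 0 < P
  Q_pos : 0 < Q
  sq_add_sq_before : p ^ 2 + P ^ 2 = 1
  sq_add_sq_inside : p ^ 2 + q ^ 2 = α ^ 2
  sq_add_sq_behind : Q ^ 2 + q ^ 2 = 1

/-- The calibration of the refracted ray: its gradient is the direction of the ray in each of the
three quadrants that the ray traverses. -/
def refractionPotential (p q P Q M : ℝ) (z : Plane) : ℝ :=
  ramp (-Q) (-p) M (z 0) + ramp P q M (-z 1)

/-- The gradient of `refractionPotential`, up to a choice of one-sided derivatives. -/
noncomputable def refractionGradient (p q P Q M : ℝ) (z : Plane) : Plane :=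
  !₂[rampSlope (-Q) (-p) M (z 0), -rampSlope P q M (-z 1)]

theorem norm_refractionGradient_le (href : IsRefraction α p q P Q) (hα : 1 ≤ α)
    (hR : HasCorner M R) (z : Plane) :
    ‖refractionGradient p q P Q M z‖ ≤ regionWeight R α z := by
  have hw := one_le_regionWeight (R := R) hα z
  have hwsq : 1 ≤ regionWeight R α z ^ 2 := one_le_pow₀ hw
  have hαsq : 1 ≤ α ^ 2 := one_le_pow₀ hα
  obtain ⟨-, -, -, -, hbefore, hinside, hbehind⟩ := href
  refine le_of_sq_le_sq ?_ (zero_le_one.trans hw)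
  rw [EuclideanSpace.norm_sq_eq, Fin.sum_univ_two]
  simp only [refractionGradient, rampSlope, Real.norm_eq_abs, sq_abs, Matrix.cons_val_zero,
    Matrix.cons_val_one]
  by_cases hz : (0 < z 0 ∧ z 0 < M) ∧ 0 < -z 1 ∧ -z 1 < M
  · have hmem : z ∈ interior R := hR.mem_interior hz.1 ⟨by linarith, by linarith⟩
    rw [regionWeight_of_mem_interior hmem, if_neg hz.1.1.not_ge, if_pos hz.1.2,
      if_neg hz.2.1.not_ge, if_pos hz.2.2]
    linarith
  · split_ifs <;> first | nlinarith | exact absurd (by constructor <;> constructor <;> linarith) hz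

theorem ae_hasDerivAt_refractionPotential_comp (hM : 0 < M) {γ : ℝ → Plane} {a b : ℝ} (hab : a ≤ b)
    {K : NNReal} (hγ : LipschitzOnWith K γ (Icc a b)) :
    ∀ᵐ τ, τ ∈ Icc a b → HasDerivAt (fun s => refractionPotential p q P Q M (γ s))
      (inner ℝ (refractionGradient p q P Q M (γ τ)) (deriv γ τ)) τ := by
  have hproj : ∀ i, LipschitzWith _ fun z : Plane => z i := fun i =>
    (EuclideanSpace.proj i : Plane →L[ℝ] ℝ).lipschitz
  have hne : ∀ c : ℝ, ∀ᵐ τ : ℝ, τ ≠ c := fun c => by simp [ae_iff]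
  filter_upwards [hγ.ae_differentiableWithinAt_of_mem_real, hne a, hne b,
    ae_hasDerivAt_ramp_comp hM hab ((hproj 0).comp_lipschitzOnWith hγ),
    ae_hasDerivAt_ramp_comp hM hab ((hproj 1).comp_lipschitzOnWith hγ).neg]
    with τ hdiff hτa hτb h0 h1 hτ
  have hderiv : HasDerivAt γ (deriv γ τ) τ := ((hdiff hτ).differentiableAt
    (Icc_mem_nhds (hτ.1.lt_of_ne' hτa) (hτ.2.lt_of_ne hτb))).hasDerivAt
  have hcoord : ∀ i, HasDerivAt (fun s => γ s i) (deriv γ τ i) τ := fun i =>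
    (EuclideanSpace.proj i : Plane →L[ℝ] ℝ).hasFDerivAt.comp_hasDerivAt τ hderiv
  have hinner : inner ℝ (refractionGradient p q P Q M (γ τ)) (deriv γ τ) =
      rampSlope (-Q) (-p) M (γ τ 0) * deriv γ τ 0 + rampSlope P q M (-γ τ 1) * -deriv γ τ 1 := by
    simp [refractionGradient, PiLp.inner_apply, mul_comm]
  rw [hinner]
  exact (h0 hτ _ (hcoord 0)).add (h1 hτ _ (hcoord 1).neg)

theorem calibrates_refractionPotential (href : IsRefraction α p q P Q) (hα : 1 ≤ α) (hM : 0 < M)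
    (hR : HasCorner M R) : Calibrates R α (refractionPotential p q P Q M) := by
  rintro γ a b hab ⟨K, hγ⟩
  have hproj : ∀ i, LipschitzOnWith _ (fun τ => γ τ i) (Icc a b) := fun i =>
    (EuclideanSpace.proj i : Plane →L[ℝ] ℝ).lipschitz.comp_lipschitzOnWith hγ
  have hac : AbsolutelyContinuousOnInterval (fun τ => refractionPotential p q P Q M (γ τ)) a b :=
    (absolutelyContinuousOnInterval_ramp_comp hab (hproj 0)).add
      (absolutelyContinuousOnInterval_ramp_comp hab (hproj 1).neg)
  rw [← hac.integral_deriv_eq_sub]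
  refine intervalIntegral.integral_mono_ae_restrict hab hac.intervalIntegrable_deriv
    (intervalIntegrable_regionWeight_mul_norm_deriv hab hγ) ?_
  rw [Filter.EventuallyLE, ae_restrict_iff' measurableSet_Icc]
  filter_upwards [ae_hasDerivAt_refractionPotential_comp hM hab hγ] with τ hderiv hτ
  calc deriv (fun s => refractionPotential p q P Q M (γ s)) τ
      = inner ℝ (refractionGradient p q P Q M (γ τ)) (deriv γ τ) := (hderiv hτ).deriv
    _ ≤ ‖refractionGradient p q P Q M (γ τ)‖ * ‖deriv γ τ‖ := real_inner_le_norm _ _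
    _ ≤ regionWeight R α (γ τ) * ‖deriv γ τ‖ := by
        gcongr
        exact norm_refractionGradient_le href hα hR _

end RefractionPotential

section RefractedChain

variable {R : Set Plane} {α p q P Q M k l m : ℝ}

/-- The vertices of the refracted ray with conserved quantities `p, q, P, Q` whose legs before,
inside and behind the region have Euclidean lengths `l`, `α * k` and `m`. -/
def refractedChain (p q P Q k l m : ℝ) : List Plane :=
  [!₂[p * (k + l), P * l], !₂[p * k, 0], !₂[0, -(q * k)], !₂[-(Q * m), -(q * (k + m))]]

theorem norm_eq_of_sq_add_sq_eq {v : Plane} {r : ℝ} (hr : 0 ≤ r) (hv : v 0 ^ 2 + v 1 ^ 2 = r ^ 2) :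
    ‖v‖ = r := by
  rw [EuclideanSpace.norm_eq, Fin.sum_univ_two]
  simp only [Real.norm_eq_abs, sq_abs, hv, Real.sqrt_sq hr]

theorem lineMap_apply_coord (x y : Plane) (τ : ℝ) (i : Fin 2) :
    (AffineMap.lineMap x y τ : Plane) i = x i + τ * (y i - x i) := by
  simp [AffineMap.lineMap_apply, add_comm]

theorem weightedLength_lineMap {x y : Plane} {w r : ℝ} (hr : 0 ≤ r)
    (hxy : (y 0 - x 0) ^ 2 + (y 1 - x 1) ^ 2 = r ^ 2)
    (hw : ∀ τ ∈ Ioo (0 : ℝ) 1, regionWeight R α (AffineMap.lineMap x y τ) = w) :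
    weightedLength R α (fun τ => AffineMap.lineMap x y τ) = w * r := by
  rw [← arcLength_zero_one, arcLength_lineMap_of_forall_eq zero_le_one hw,
    norm_eq_of_sq_add_sq_eq (v := y - x) hr hxy, sub_zero, one_mul]

theorem regionWeight_lineMap_eq_one_of_nonneg (hR : HasCorner M R) (hα : 1 ≤ α) {x y : Plane}
    (hx : 0 ≤ x 1) (hy : 0 ≤ y 1) {τ : ℝ} (hτ : τ ∈ Ioo 0 1) :
    regionWeight R α (AffineMap.lineMap x y τ) = 1 := by
  refine regionWeight_of_notMem_interior hα fun hmem => ?_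
  have hneg := (hR.pos_and_neg_of_mem_interior hmem).2
  rw [lineMap_apply_coord] at hneg
  linarith [mul_nonneg (sub_nonneg.mpr hτ.2.le) hx, mul_nonneg hτ.1.le hy]

theorem regionWeight_lineMap_eq_one_of_nonpos (hR : HasCorner M R) (hα : 1 ≤ α) {x y : Plane}
    (hx : x 0 ≤ 0) (hy : y 0 ≤ 0) {τ : ℝ} (hτ : τ ∈ Ioo 0 1) :
    regionWeight R α (AffineMap.lineMap x y τ) = 1 := by
  refine regionWeight_of_notMem_interior hα fun hmem => ?_
  have hpos := (hR.pos_and_neg_of_mem_interior hmem).1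
  rw [lineMap_apply_coord] at hpos
  linarith [mul_nonneg (sub_nonneg.mpr hτ.2.le) (neg_nonneg.mpr hx),
    mul_nonneg hτ.1.le (neg_nonneg.mpr hy)]

theorem regionWeight_lineMap_eq_of_mem_Ioc (hR : HasCorner M R) {a b : ℝ} (ha : a ∈ Ioc 0 M)
    (hb : b ∈ Ioc 0 M) {τ : ℝ} (hτ : τ ∈ Ioo 0 1) :
    regionWeight R α (AffineMap.lineMap (!₂[a, 0] : Plane) !₂[0, -b] τ) = α := by
  apply regionWeight_of_mem_interior
  have ha₁ := mul_pos ha.1 hτ.1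
  have ha₂ := mul_pos ha.1 (sub_pos.mpr hτ.2)
  have hb₁ := mul_pos hb.1 hτ.1
  have hb₂ := mul_pos hb.1 (sub_pos.mpr hτ.2)
  apply hR.mem_interior <;> simp only [lineMap_apply_coord, Matrix.cons_val_zero,
    Matrix.cons_val_one, Matrix.cons_val_fin_one, mem_Ioo] <;>
    constructor <;> linarith [ha.2, hb.2]

theorem chainLength_refractedChain (href : IsRefraction α p q P Q) (hα : 1 ≤ α)
    (hR : HasCorner M R) (hk : 0 < k) (hl : 0 ≤ l) (hm : 0 ≤ m) (hpM : p * k ≤ M)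
    (hqM : q * k ≤ M) : chainLength R α (refractedChain p q P Q k l m) = l + α ^ 2 * k + m := by
  obtain ⟨hp, hq, hP, hQ, hbefore, hinside, hbehind⟩ := href
  have hfirst := weightedLength_lineMap (R := R) (α := α) (x := !₂[p * (k + l), P * l])
    (y := !₂[p * k, 0]) hl (by simp; linear_combination l ^ 2 * hbefore) fun τ hτ =>
    regionWeight_lineMap_eq_one_of_nonneg hR hα (mul_nonneg hP.le hl) le_rfl hτ
  have hmiddle := weightedLength_lineMap (R := R) (α := α) (r := α * k) (x := !₂[p * k, 0])
    (y := !₂[0, -(q * k)]) (by positivity) (by simp; linear_combination k ^ 2 * hinside) fun τ hτ =>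
    regionWeight_lineMap_eq_of_mem_Ioc hR ⟨mul_pos hp hk, hpM⟩ ⟨mul_pos hq hk, hqM⟩ hτ
  have hlast := weightedLength_lineMap (R := R) (α := α) (x := !₂[0, -(q * k)])
    (y := !₂[-(Q * m), -(q * (k + m))]) hm (by simp; linear_combination m ^ 2 * hbehind) fun τ hτ =>
    regionWeight_lineMap_eq_one_of_nonpos hR hα le_rfl (neg_nonpos.mpr (mul_nonneg hQ.le hm)) hτ
  simp only [refractedChain, chainLength, hfirst, hmiddle, hlast]
  ring

theorem refractionPotential_of_before (hM : 0 ≤ M) {z : Plane} (h0 : z 0 ∈ Icc 0 M)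
    (h1 : 0 ≤ z 1) : refractionPotential p q P Q M z = -(p * z 0 + P * z 1) := by
  rw [refractionPotential, ramp_of_mem_Icc h0, ramp_of_nonpos hM (neg_nonpos.mpr h1)]
  ring

theorem refractionPotential_of_behind (hM : 0 ≤ M) {z : Plane} (h0 : z 0 ≤ 0)
    (h1 : -z 1 ∈ Icc 0 M) : refractionPotential p q P Q M z = -(Q * z 0 + q * z 1) := by
  rw [refractionPotential, ramp_of_nonpos hM h0, ramp_of_mem_Icc h1]
  ring

theorem chainLength_refractedChain_eq_sub (href : IsRefraction α p q P Q) (hα : 1 ≤ α)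
    (hR : HasCorner M R) (hk : 0 < k) (hl : 0 ≤ l) (hm : 0 ≤ m) (hpM : p * (k + l) ≤ M)
    (hqM : q * (k + m) ≤ M) :
    chainLength R α (refractedChain p q P Q k l m) =
      refractionPotential p q P Q M !₂[-(Q * m), -(q * (k + m))] -
        refractionPotential p q P Q M !₂[p * (k + l), P * l] := by
  obtain ⟨hp, hq, hP, hQ, hbefore, hinside, hbehind⟩ := id href
  have hpl := mul_nonneg hp.le hl
  have hqm := mul_nonneg hq.le hm
  have hpkl : 0 ≤ p * (k + l) := by positivity
  have hqkm : 0 ≤ q * (k + m) := by positivity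
  have hbehindφ : refractionPotential p q P Q M !₂[-(Q * m), -(q * (k + m))] =
      -(Q * -(Q * m) + q * -(q * (k + m))) :=
    refractionPotential_of_behind (hpkl.trans hpM) (neg_nonpos.mpr (mul_nonneg hQ.le hm))
      (by simpa using ⟨hqkm, hqM⟩)
  have hbeforeφ : refractionPotential p q P Q M !₂[p * (k + l), P * l] =
      -(p * (p * (k + l)) + P * (P * l)) :=
    refractionPotential_of_before (hpkl.trans hpM) ⟨hpkl, hpM⟩ (mul_nonneg hP.le hl)
  rw [chainLength_refractedChain href hα hR hk hl hm (by linarith) (by linarith), hbehindφ,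
    hbeforeφ]
  linear_combination -k * hinside - l * hbefore - m * hbehind

theorem IsRefraction.sameRay_of_tight_segment (href : IsRefraction α p q P Q) (hα : 1 ≤ α)
    (hR : HasCorner M R) {s v : Plane} (hs0 : s 0 ∈ Ioo 0 M) (hs1 : 0 < s 1)
    (hv : weightedLength R α (fun τ => AffineMap.lineMap s v τ) ≤
      refractionPotential p q P Q M v - refractionPotential p q P Q M s) :
    SameRay ℝ !₂[-p, -P] (v - s) := by
  have hM : 0 < M := hs0.1.trans hs0.2
  have hcoord : ∀ i, Continuous fun z : Plane => z i := fun i => by fun_prop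
  have hU : {z : Plane | z 0 ∈ Ioo 0 M ∧ 0 < z 1} ∈ nhds s :=
    ((isOpen_Ioo.preimage (hcoord 0)).inter (isOpen_Ioi.preimage (hcoord 1))).mem_nhds ⟨hs0, hs1⟩
  have hnorm : ‖(!₂[-p, -P] : Plane)‖ = 1 :=
    norm_eq_of_sq_add_sq_eq zero_le_one (by simpa using href.sq_add_sq_before)
  refine (calibrates_refractionPotential href hα hM hR).sameRay_of_tight_segment hU
    (fun z hz => ?_) (fun z hz => ?_) hv
  · rw [hnorm]
    exact regionWeight_of_notMem_interior hα fun hmem =>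
      (hR.pos_and_neg_of_mem_interior hmem).2.not_gt hz.2
  · rw [refractionPotential_of_before hM.le (Ioo_subset_Icc_self hz.1) hz.2.le,
      refractionPotential_of_before hM.le (Ioo_subset_Icc_self hs0) hs1.le]
    simp only [PiLp.inner_apply, Fin.sum_univ_two, PiLp.sub_apply, RCLike.inner_apply',
      conj_trivial, Matrix.cons_val_zero, Matrix.cons_val_one, Matrix.cons_val_fin_one]
    ring

theorem div_eq_of_sameRay {x y : ℝ} (hxy : !₂[x, y] ≠ (0 : Plane)) {v : Plane} (hv : v ≠ 0)
    (h : SameRay ℝ !₂[x, y] v) : v 0 / v 1 = x / y := by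
  obtain ⟨r, hr, rfl⟩ := h.exists_pos_left hxy hv
  exact mul_div_mul_left x y hr.ne'

theorem isShortestChain_refractedChain (href : IsRefraction α p q P Q) (hα : 1 ≤ α)
    (hR : HasCorner M R) (hk : 0 < k) (hl : 0 ≤ l) (hm : 0 ≤ m) (hpM : p * (k + l) ≤ M)
    (hqM : q * (k + m) ≤ M) :
    IsShortestChain R α !₂[p * (k + l), P * l] !₂[-(Q * m), -(q * (k + m))]
      (refractedChain p q P Q k l m) := by
  have hM : 0 < M := (mul_pos href.p_pos (by linarith)).trans_le hpM
  exact (calibrates_refractionPotential href hα hM hR).isShortestChain rfl rfl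
    (chainLength_refractedChain_eq_sub href hα hR hk hl hm hpM hqM).le

theorem IsShortestChain.exists_div_eq {L : List Plane} (href : IsRefraction α p q P Q)
    (hα : 1 ≤ α) (hR : HasCorner M R) (hk : 0 < k) (hl : 0 < l) (hm : 0 ≤ m)
    (hpM : p * (k + l) < M) (hqM : q * (k + m) ≤ M)
    (hL : IsShortestChain R α !₂[p * (k + l), P * l] !₂[-(Q * m), -(q * (k + m))] L) :
    ∃ v ∈ L, (v 0 - p * (k + l)) / (v 1 - P * l) = p / P := by
  have hs0 := mul_pos href.p_pos (add_pos hk hl)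
  have hs1 := mul_pos href.P_pos hl
  have hcal := calibrates_refractionPotential href hα (hs0.trans hpM) hR
  obtain ⟨l', rfl⟩ := List.head?_eq_some_iff.mp hL.head_eq
  have hst : !₂[p * (k + l), P * l] ≠ (!₂[-(Q * m), -(q * (k + m))] : Plane) := fun h => by
    have h0 : p * (k + l) = -(Q * m) := congrArg (fun z : Plane => z 0) h
    linarith [mul_nonneg href.Q_pos.le hm]
  obtain ⟨v, hvl, hvs, htight⟩ := hcal.exists_tight_segment hst l' hL.last_eq <|
    (hL.chainLength_le rfl).trans_eq <|
      chainLength_refractedChain_eq_sub href hα hR hk hl.le hm hpM.le hqM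
  have hray := href.sameRay_of_tight_segment hα hR ⟨hs0, hpM⟩ hs1 htight
  refine ⟨v, List.mem_cons_of_mem _ hvl, ?_⟩
  have hgrad : !₂[-p, -P] ≠ (0 : Plane) := fun h =>
    href.p_pos.ne' (neg_eq_zero.mp (congrArg (fun z : Plane => z 0) h))
  rw [← neg_div_neg_eq p P]
  exact div_eq_of_sameRay hgrad (sub_ne_zero.mpr hvs) hray

end RefractedChain

section RefractionParameters

theorem div_sqrt_mem_Icc {c x l u : ℝ} (hc : 0 ≤ c) (hl : 0 < l) (hu : 0 ≤ u) (hlx : l ^ 2 ≤ x)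
    (hxu : x ≤ u ^ 2) : c / √x ∈ Icc (c / u) (c / l) := by
  have hlsqrt : l ≤ √x := Real.le_sqrt_of_sq_le hlx
  exact ⟨div_le_div_of_nonneg_left hc (hl.trans_le hlsqrt) ((Real.sqrt_le_left hu).mpr hxu),
    div_le_div_of_nonneg_left hc hl hlsqrt⟩

/-- For the ray with `α = 7 / 5` and `p ^ 2 = (49 + W) / 50` that joins `(27, 2)` to the vertical
axis and the one that joins the horizontal axis to `(-1, -6)`, the difference of the lengths
inside the fourth quadrant, divided by `α`. -/
noncomputable def rayMismatch (W : ℝ) : ℝ :=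
  27 / √((49 + W) / 50) - 2 / √((1 - W) / 50) - (6 / √((49 - W) / 50) - 1 / √((1 + W) / 50))

theorem continuousOn_rayMismatch : ContinuousOn rayMismatch (Ioo (-1) 1) := by
  have hsqrt : ∀ {g : ℝ → ℝ}, Continuous g → (∀ x ∈ Ioo (-1 : ℝ) 1, 0 < g x) → ∀ c : ℝ,
      ContinuousOn (fun x => c / √(g x)) (Ioo (-1) 1) := fun hg hpos c =>
    continuousOn_const.div hg.sqrt.continuousOn fun x hx => (Real.sqrt_pos.mpr (hpos x hx)).ne'
  refine ((hsqrt ?_ ?_ _).sub (hsqrt ?_ ?_ _)).sub ((hsqrt ?_ ?_ _).sub (hsqrt ?_ ?_ _))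
  all_goals first | fun_prop | (intro x hx; linarith [hx.1, hx.2])

theorem rayMismatch_pos : 0 < rayMismatch (7 / 10) := by
  have h27 := (div_sqrt_mem_Icc (c := 27) (x := (49 + 7 / 10) / 50) (l := 0.9) (u := 0.998)
    (by norm_num) (by norm_num) (by norm_num) (by norm_num) (by norm_num)).1
  have h2 := (div_sqrt_mem_Icc (c := 2) (x := (1 - 7 / 10) / 50) (l := 0.0774) (u := 0.08)
    (by norm_num) (by norm_num) (by norm_num) (by norm_num) (by norm_num)).2
  have h6 := (div_sqrt_mem_Icc (c := 6) (x := (49 - 7 / 10) / 50) (l := 0.98) (u := 1)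
    (by norm_num) (by norm_num) (by norm_num) (by norm_num) (by norm_num)).2
  have h1 := (div_sqrt_mem_Icc (c := 1) (x := (1 + 7 / 10) / 50) (l := 0.18) (u := 0.1845)
    (by norm_num) (by norm_num) (by norm_num) (by norm_num) (by norm_num)).1
  norm_num [rayMismatch] at h27 h2 h6 h1 ⊢
  linarith

theorem rayMismatch_neg : rayMismatch (18 / 25) < 0 := by
  have h27 := (div_sqrt_mem_Icc (c := 27) (x := (49 + 18 / 25) / 50) (l := 0.997) (u := 1)
    (by norm_num) (by norm_num) (by norm_num) (by norm_num) (by norm_num)).2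
  have h2 := (div_sqrt_mem_Icc (c := 2) (x := (1 - 18 / 25) / 50) (l := 0.07) (u := 0.0749)
    (by norm_num) (by norm_num) (by norm_num) (by norm_num) (by norm_num)).1
  have h6 := (div_sqrt_mem_Icc (c := 6) (x := (49 - 18 / 25) / 50) (l := 0.9) (u := 1)
    (by norm_num) (by norm_num) (by norm_num) (by norm_num) (by norm_num)).1
  have h1 := (div_sqrt_mem_Icc (c := 1) (x := (1 + 18 / 25) / 50) (l := 0.185) (u := 0.2)
    (by norm_num) (by norm_num) (by norm_num) (by norm_num) (by norm_num)).2
  norm_num [rayMismatch] at h27 h2 h6 h1 ⊢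
  linarith

theorem isRefraction_of_sq_eq {p q P Q W : ℝ} (hp : 0 < p) (hq : 0 < q) (hP : 0 < P) (hQ : 0 < Q)
    (hpW : p ^ 2 = (49 + W) / 50) (hqW : q ^ 2 = (49 - W) / 50) (hPW : P ^ 2 = (1 - W) / 50)
    (hQW : Q ^ 2 = (1 + W) / 50) : IsRefraction (7 / 5) p q P Q where
  p_pos := hp
  q_pos := hq
  P_pos := hP
  Q_pos := hQ
  sq_add_sq_before := by rw [hpW, hPW]; ring
  sq_add_sq_inside := by rw [hpW, hqW]; ring
  sq_add_sq_behind := by rw [hqW, hQW]; ring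

/-- The real numbers that are computable in the algebraic computation model, as a field. -/
noncomputable def acmField : IntermediateField ℚ ℝ :=
  (solvableByRad ℚ ℂ).comap (IsScalarTower.toAlgHom ℚ ℝ ℂ)

theorem mem_acmField {x : ℝ} : x ∈ acmField ↔ ACMComputable x := Iff.rfl

theorem sq_mem_of_div_mem {K L : Type*} [Field K] [Field L] [Algebra K L]
    {E : IntermediateField K L} {x y : L} (hxy : x ^ 2 + y ^ 2 = 1) (hy : y ≠ 0) (h : x / y ∈ E) :
    x ^ 2 ∈ E := by
  have hsq : x ^ 2 = (x / y) ^ 2 / ((x / y) ^ 2 + 1) := by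
    rw [div_pow, div_add_one (pow_ne_zero 2 hy), hxy, div_div_div_cancel_right₀ (pow_ne_zero 2 hy),
      div_one]
  rw [hsq]
  exact div_mem (pow_mem h 2) (add_mem (pow_mem h 2) (one_mem E))

theorem exists_isRefraction_not_ACMComputable : ∃ p q P Q : ℝ, IsRefraction (7 / 5) p q P Q ∧
    27 / p - 2 / P = 6 / q - 1 / Q ∧ 0 < 27 / p - 2 / P ∧ ¬ ACMComputable (p / P) := by
  obtain ⟨W, ⟨hW₁, hW₂⟩, hmismatch⟩ := intermediate_value_Icc' (by norm_num)
    (continuousOn_rayMismatch.mono (Icc_subset_Ioo (by norm_num) (by norm_num)))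
    ⟨rayMismatch_neg.le, rayMismatch_pos.le⟩
  have hsqrt : ∀ {x : ℝ}, 0 < x → 0 < √x ∧ √x ^ 2 = x := fun h =>
    ⟨Real.sqrt_pos.mpr h, Real.sq_sqrt h.le⟩
  obtain ⟨hp, hpW⟩ := hsqrt (show 0 < (49 + W) / 50 by linarith)
  obtain ⟨hq, hqW⟩ := hsqrt (show 0 < (49 - W) / 50 by linarith)
  obtain ⟨hP, hPW⟩ := hsqrt (show 0 < (1 - W) / 50 by linarith)
  obtain ⟨hQ, hQW⟩ := hsqrt (show 0 < (1 + W) / 50 by linarith)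
  have hsnell := sub_eq_zero.mp hmismatch
  have href := isRefraction_of_sq_eq hp hq hP hQ hpW hqW hPW hQW
  refine ⟨_, _, _, _, href, hsnell, ?_, ?_⟩
  · have h27 := (div_sqrt_mem_Icc (c := 27) (x := (49 + W) / 50) (l := 0.9) (u := 0.998)
      (by norm_num) (by norm_num) (by norm_num) (by linarith) (by linarith)).1
    have h2 := (div_sqrt_mem_Icc (c := 2) (x := (1 - W) / 50) (l := 0.0745) (u := 0.1)
      (by norm_num) (by norm_num) (by norm_num) (by linarith) (by linarith)).2
    norm_num at h27 h2 ⊢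
    linarith
  · intro hcomp
    have hpmem := sq_mem_of_div_mem href.sq_add_sq_before hP.ne' (mem_acmField.mpr hcomp)
    refine not_ACMComputable_of_aeval_refractionPoly_eq_zero (by linarith)
      (aeval_refractionPoly_eq_zero hp hq hP hQ hpW hqW hPW hQW (by linarith) hsnell) ?_
    rw [show (9 * W - 407) / 2 = 225 * √((49 + W) / 50) ^ 2 - 424 by rw [hpW]; ring]
    exact mem_acmField.mp (sub_mem (mul_mem (ofNat_mem _ 225) hpmem) (ofNat_mem _ 424))

end RefractionParameters

section RadicalUnsolvability

theorem hasCorner_quadrant (M : ℝ) : HasCorner M (quadrant 0) :=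
  ⟨fun _ hx => ⟨hx.1, hx.2.2.2⟩, Subset.rfl⟩

theorem hasCorner_rectangle (M : ℝ) : HasCorner M (rectangle !₂[0, -M] !₂[M, 0]) :=
  ⟨Subset.rfl, fun _ hx => ⟨hx.1, hx.2.2.2⟩⟩

theorem ratPoint_zero : ratPoint 0 = 0 := by
  ext i
  fin_cases i <;> simp [ratPoint]

theorem exists_isShortestChain_and_not_solvableInACM {M : ℝ} {R : Set Plane} (hM : 27 < M)
    (hR : HasCorner M R) : (∃ L, IsShortestChain R (7 / 5) !₂[27, 2] !₂[-1, -6] L) ∧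
      ¬ SolvableInACM R (7 / 5) !₂[27, 2] !₂[-1, -6] := by
  obtain ⟨p, q, P, Q, href, hsnell, hk, hnot⟩ := exists_isRefraction_not_ACMComputable
  obtain ⟨hp, hq, hP, hQ, -⟩ := id href
  have hα : (1 : ℝ) ≤ 7 / 5 := by norm_num
  have hl : 0 < 2 / P := by positivity
  have hm : 0 < 1 / Q := by positivity
  set k := 27 / p - 2 / P with hk_def
  have hs0 : p * (k + 2 / P) = 27 := by rw [hk_def]; field_simp; ring
  have ht1 : q * (k + 1 / Q) = 6 := by rw [hsnell]; field_simp; ring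
  have hs : (!₂[p * (k + 2 / P), P * (2 / P)] : Plane) = !₂[27, 2] := by
    rw [hs0, mul_div_cancel₀ 2 hP.ne']
  have ht : (!₂[-(Q * (1 / Q)), -(q * (k + 1 / Q))] : Plane) = !₂[-1, -6] := by
    rw [ht1, mul_div_cancel₀ 1 hQ.ne']
  rw [← hs, ← ht]
  refine ⟨⟨_, isShortestChain_refractedChain href hα hR hk hl.le hm.le (by linarith)
    (by linarith)⟩, fun ⟨L, hL, hcomp⟩ => hnot ?_⟩
  obtain ⟨v, hvL, hv⟩ := hL.exists_div_eq href hα hR hk hl hm.le (by linarith) (by linarith)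
  rw [← hv, hs0, mul_div_cancel₀ 2 hP.ne', ← mem_acmField]
  exact div_mem (sub_mem (mem_acmField.mpr (hcomp v hvL 0)) (ofNat_mem _ 27))
    (sub_mem (mem_acmField.mpr (hcomp v hvL 1)) (ofNat_mem _ 2))

end RadicalUnsolvability

theorem theorem2 :
    (∃ (α : ℚ) (O s t : ℚ × ℚ),
      0 < (α : ℝ) ∧ (α : ℝ) < √2 ∧ α ≠ 1 ∧
      ratPoint s ∉ quadrant (ratPoint O) ∧ ratPoint t ∉ quadrant (ratPoint O) ∧
      (∃ L, IsShortestChain (quadrant (ratPoint O)) α (ratPoint s) (ratPoint t) L) ∧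
      ¬ SolvableInACM (quadrant (ratPoint O)) α (ratPoint s) (ratPoint t)) ∧
    (∃ (α : ℚ) (A B s t : ℚ × ℚ),
      0 < (α : ℝ) ∧ (α : ℝ) < √2 ∧ α ≠ 1 ∧ A.1 < B.1 ∧ A.2 < B.2 ∧
      ratPoint s ∉ rectangle (ratPoint A) (ratPoint B) ∧
      ratPoint t ∉ rectangle (ratPoint A) (ratPoint B) ∧
      (∃ L, IsShortestChain (rectangle (ratPoint A) (ratPoint B)) α (ratPoint s) (ratPoint t) L) ∧
      ¬ SolvableInACM (rectangle (ratPoint A) (ratPoint B)) α (ratPoint s) (ratPoint t)) := by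
  have hα : ((7 / 5 : ℚ) : ℝ) = 7 / 5 := by norm_num
  have hs : ratPoint (27, 2) = !₂[27, 2] := by simp [ratPoint]
  have ht : ratPoint (-1, -6) = !₂[-1, -6] := by simp [ratPoint]
  have hpos : 0 < ((7 / 5 : ℚ) : ℝ) := by norm_num
  have hlt : ((7 / 5 : ℚ) : ℝ) < √2 := hα ▸ Real.lt_sqrt_of_sq_lt (by norm_num)
  have hne : (7 / 5 : ℚ) ≠ 1 := by norm_num
  have hcorner : ∀ {R : Set Plane}, HasCorner 100 R →
      ratPoint (27, 2) ∉ R ∧ ratPoint (-1, -6) ∉ R ∧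
      (∃ L, IsShortestChain R (7 / 5 : ℚ) (ratPoint (27, 2)) (ratPoint (-1, -6)) L) ∧
      ¬ SolvableInACM R (7 / 5 : ℚ) (ratPoint (27, 2)) (ratPoint (-1, -6)) := fun hR => by
    rw [hα, hs, ht]
    exact ⟨hR.notMem_of_pos (by simp), hR.notMem_of_neg (by simp),
      exists_isShortestChain_and_not_solvableInACM (by norm_num) hR⟩
  have hquadrant : HasCorner 100 (quadrant (ratPoint 0)) :=
    ratPoint_zero ▸ hasCorner_quadrant 100
  have hrectangle : HasCorner 100 (rectangle (ratPoint (0, -100)) (ratPoint (100, 0))) := by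
    simpa [ratPoint] using hasCorner_rectangle 100
  exact ⟨⟨7 / 5, 0, (27, 2), (-1, -6), hpos, hlt, hne, hcorner hquadrant⟩,
    7 / 5, (0, -100), (100, 0), (27, 2), (-1, -6), hpos, hlt, hne, by norm_num, by norm_num,
    hcorner hrectangle⟩
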